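/- Let $p$ be an odd prime, let $M$ and $G$ be finite $p$-groups, and let $\mu: M\to G$ be a crossed module, i.e. a homomorphism together with an action of $G$ on $M$ by automorphisms such that $\mu({}^g m)=g\mu(m)g^{-1}$ and ${}^{\mu(m)}m'=mm'm^{-1}$ for all $g\in G$, $m,m'\in M$. For a group $H$ write $H^p$ for the subgroup generated by all $p$-th powers of elements of $H$. A finite $p$-group $H$ is powerful if $[H,H]\le H^p$, and a normal subgroup $N$ of $H$ is powerfully embedded in $H$ if $[N,H]\le N^p$ (recall that $p$ is odd). Let $G$ act on itself by conjugation and let $M$ act on $M$ and on $G$ through $\mu$. The nonabelian tensor product $M\otimes G$ is the group generated by the symbols $m\otimes g$ ($m\in M$, $g\in G$) with relations $$m\otimes gg'=(m\otimes g)({}^{g}m\otimes {}^{g}g'),\qquad mm'\otimes g=({}^{m}m'\otimes {}^{m}g)(m\otimes g).$$ Let $K=\{(m,g)\in M\times G \mid \mu(m)=g\}$, with projections $\pi_1:K\to M$ and $\pi_2:K\to G$; it acts on $M$ and $G$ through its image in $G$. The tensor product modulo $p$, $M\otimes^p G$, is the group generated by the symbols $m\otimes g$ and $\{k\}$ ($m\in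 M$, $g\in G$, $k\in K$) with the two families of relations above and the relations $$\{k\}(m\otimes g)\{k\}^{-1}={}^{k^p}m\otimes {}^{k^p}g,\qquad \{kk'\}=\{k\}\prod_{i=1}^{p-1}\bigl(\pi_1(k)^{-1}\otimes({}^{k^{1-p+i}}\pi_2(k'))^{i}\bigr)\{k'\},$$ $$[\{k\},\{k'\}]=\pi_1(k)^p\otimes\pi_2(k')^p,\qquad \{(m\,{}^{g}m^{-1},\,{}^{m}g\,g^{-1})\}=(m\otimes g)^p,$$ for all $m,m'\in M$, $g,g'\in G$, $k,k'\in K$, where $[a,b]=aba^{-1}b^{-1}$ and the product is taken in the order of increasing $i$. Suppose that $M$ is powerful and that $\mu(M)$ is powerfully embedded in $G$. Then: (i) the image of the natural homomorphism $M^p\otimes G\to M\otimes G$ is contained in $(M\otimes G)^p$, where $M^p\otimes G$ is formed with the restricted crossed module $M^p\to G$; (ii) $M\otimes G$ is a finite powerful $p$-group; (iii) $M\otimes^p G$ is a finite powerful $p$-group. -/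

import Mathlib

universe u u' v w

/-- A crossed module `μ : M → P`: a homomorphism `toHom` together with an action `act` of `P` on
`M` by automorphisms such that `μ(ᵍm) = g μ(m) g⁻¹` and `^{μ(m)}m' = m m' m⁻¹`. -/
structure CrossedModule (M : Type u) (P : Type w) [Group M] [Group P] where
  toHom : M →* P
  act : P →* MulAut M
  toHom_act : ∀ (g : P) (m : M), toHom (act g m) = g * toHom m * g⁻¹
  act_toHom : ∀ m m' : M, act (toHom m) m' = m * m' * m⁻¹

namespace CrossedModule

variable {M : Type u} {M' : Type u'} {N : Type v} {P : Type w}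
  [Group M] [Group M'] [Group N] [Group P]

/-- The crossed module `id : P → P`, with `P` acting on itself by conjugation. -/
def identity (P : Type w) [Group P] : CrossedModule P P where
  toHom := MonoidHom.id P
  act := MulAut.conj
  toHom_act := fun _ _ => rfl
  act_toHom := fun _ _ => rfl

/-- The restriction of a crossed module `M → P` to a `P`-invariant subgroup of `M`. -/
def restrict (X : CrossedModule M P) (H : Subgroup M)
    (hH : ∀ (g : P), ∀ m ∈ H, X.act g m ∈ H) : CrossedModule H P where
  toHom := X.toHom.comp H.subtype
  act :=
    { toFun := fun g =>
        { toFun := fun m => ⟨X.act g m, hH g m m.2⟩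
          invFun := fun m => ⟨X.act g⁻¹ m, hH g⁻¹ m m.2⟩
          left_inv := fun m => Subtype.ext (by simp)
          right_inv := fun m => Subtype.ext (by simp)
          map_mul' := fun a b => Subtype.ext (by simp) }
      map_one' := by ext m; simp
      map_mul' := fun a b => by ext m; simp }
  toHom_act := fun g m => X.toHom_act g m
  act_toHom := fun m m' => Subtype.ext (X.act_toHom m m')

/-! ### The nonabelian tensor product -/

/-- The defining relators of `M ⊗ N`, for crossed modules `X : M → P` and `Y : N → P`. All the
groups act on `M` and `N` through `P`; the generator `(m, n)` stands for `m ⊗ n`. -/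
inductive TensorRel (X : CrossedModule M P) (Y : CrossedModule N P) : FreeGroup (M × N) → Prop
  /-- `m ⊗ nn' = (m ⊗ n)(ⁿm ⊗ ⁿn')` -/
  | right (m : M) (n n' : N) : TensorRel X Y
      (FreeGroup.of (m, n * n') *
        (FreeGroup.of (m, n) *
          FreeGroup.of (X.act (Y.toHom n) m, Y.act (Y.toHom n) n'))⁻¹)
  /-- `mm' ⊗ n = (ᵐm' ⊗ ᵐn)(m ⊗ n)` -/
  | left (m m' : M) (n : N) : TensorRel X Y
      (FreeGroup.of (m * m', n) *
        (FreeGroup.of (X.act (X.toHom m) m', Y.act (X.toHom m) n) *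
          FreeGroup.of (m, n))⁻¹)

/-- The nonabelian tensor product `M ⊗ N` of two crossed modules `M → P` and `N → P`. -/
abbrev Tensor (X : CrossedModule M P) (Y : CrossedModule N P) : Type (max u v) :=
  PresentedGroup {r | TensorRel X Y r}

/-- The generator `m ⊗ n` of `M ⊗ N`. -/
def tmul (X : CrossedModule M P) (Y : CrossedModule N P) (m : M) (n : N) : Tensor X Y :=
  PresentedGroup.of (m, n)

theorem tmul_mul (X : CrossedModule M P) (Y : CrossedModule N P) (m : M) (n n' : N) :
    tmul X Y m (n * n') =
      tmul X Y m n * tmul X Y (X.act (Y.toHom n) m) (Y.act (Y.toHom n) n') :=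
  PresentedGroup.mk_eq_mk_of_mul_inv_mem (TensorRel.right m n n')

theorem mul_tmul (X : CrossedModule M P) (Y : CrossedModule N P) (m m' : M) (n : N) :
    tmul X Y (m * m') n =
      tmul X Y (X.act (X.toHom m) m') (Y.act (X.toHom m) n) * tmul X Y m n :=
  PresentedGroup.mk_eq_mk_of_mul_inv_mem (TensorRel.left m m' n)

/-- The homomorphism `M' ⊗ N → M ⊗ N`, `m ⊗ n ↦ f(m) ⊗ n`, induced by a morphism `f : M' → M` of
crossed modules over `P`. -/
def Tensor.mapLeft {X' : CrossedModule M' P} {X : CrossedModule M P} (Y : CrossedModule N P)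
    (f : M' →* M) (hf : ∀ m, X.toHom (f m) = X'.toHom m)
    (hact : ∀ g m, f (X'.act g m) = X.act g (f m)) : Tensor X' Y →* Tensor X Y :=
  PresentedGroup.toGroup (f := fun x : M' × N => tmul X Y (f x.1) x.2) (by
    rintro r (⟨m, n, n'⟩ | ⟨m, m', n⟩)
    · simp only [map_mul, map_inv, FreeGroup.lift_apply_of, hact]
      rw [tmul_mul, mul_inv_cancel]
    · simp only [map_mul, map_inv, FreeGroup.lift_apply_of, hact, ← hf]
      rw [mul_tmul, mul_inv_cancel])

/-! ### The tensor product modulo `q` -/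

/-- The pullback `K = M ×_P N = {(m, n) | μ(m) = ν(n)}`. -/
def pullback (X : CrossedModule M P) (Y : CrossedModule N P) : Subgroup (M × N) :=
  (X.toHom.comp (MonoidHom.fst M N)).eqLocus (Y.toHom.comp (MonoidHom.snd M N))

/-- The image in `P` of an element of the pullback. -/
def pullbackHom (X : CrossedModule M P) (Y : CrossedModule N P) : pullback X Y →* P :=
  (X.toHom.comp (MonoidHom.fst M N)).comp (pullback X Y).subtype

/-- The element `(m ⁿm⁻¹, ᵐn n⁻¹)` of the pullback. -/
def pullbackComm (X : CrossedModule M P) (Y : CrossedModule N P) (m : M) (n : N) :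
    pullback X Y :=
  ⟨(m * X.act (Y.toHom n) m⁻¹, Y.act (X.toHom m) n * n⁻¹), by
    change X.toHom (m * X.act (Y.toHom n) m⁻¹) = Y.toHom (Y.act (X.toHom m) n * n⁻¹)
    simp only [map_mul, toHom_act, map_inv]
    group⟩

/-- The generators of the tensor product modulo `q`: the symbols `m ⊗ n` and `{k}`. -/
inductive QTensorGen (X : CrossedModule M P) (Y : CrossedModule N P) : Type (max u v)
  | tmul (m : M) (n : N) : QTensorGen X Y
  | brace (k : pullback X Y) : QTensorGen X Y

/-- The symbol `m ⊗ n` in the free group on the generators. -/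
def symT (X : CrossedModule M P) (Y : CrossedModule N P) (m : M) (n : N) :
    FreeGroup (QTensorGen X Y) :=
  FreeGroup.of (QTensorGen.tmul m n)

/-- The symbol `{k}` in the free group on the generators. -/
def symB (X : CrossedModule M P) (Y : CrossedModule N P) (k : pullback X Y) :
    FreeGroup (QTensorGen X Y) :=
  FreeGroup.of (QTensorGen.brace k)

/-- The defining relators of the tensor product modulo `q` of crossed modules `X : M → P` and
`Y : N → P`. All the groups, including the pullback, act on `M` and `N` through `P`. -/
inductive QTensorRel (q : ℕ) (X : CrossedModule M P) (Y : CrossedModule N P) :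
    FreeGroup (QTensorGen X Y) → Prop
  /-- `m ⊗ nn' = (m ⊗ n)(ⁿm ⊗ ⁿn')` -/
  | right (m : M) (n n' : N) : QTensorRel q X Y
      (symT X Y m (n * n') *
        (symT X Y m n * symT X Y (X.act (Y.toHom n) m) (Y.act (Y.toHom n) n'))⁻¹)
  /-- `mm' ⊗ n = (ᵐm' ⊗ ᵐn)(m ⊗ n)` -/
  | left (m m' : M) (n : N) : QTensorRel q X Y
      (symT X Y (m * m') n *
        (symT X Y (X.act (X.toHom m) m') (Y.act (X.toHom m) n) * symT X Y m n)⁻¹)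
  /-- `{k}(m ⊗ n){k}⁻¹ = ^{k^q}m ⊗ ^{k^q}n` -/
  | conj (k : pullback X Y) (m : M) (n : N) : QTensorRel q X Y
      (symB X Y k * symT X Y m n * (symB X Y k)⁻¹ *
        (symT X Y (X.act (pullbackHom X Y (k ^ q)) m)
          (Y.act (pullbackHom X Y (k ^ q)) n))⁻¹)
  /-- `{kk'} = {k} ∏_{i=1}^{q-1} (π₁k⁻¹ ⊗ (^{k^{1-q+i}}π₂k')^i) {k'}`, the factors of the product
  in the order of increasing `i` -/
  | mul (k k' : pullback X Y) : QTensorRel q X Y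
      (symB X Y (k * k') *
        (symB X Y k *
          ((List.range' 1 (q - 1)).map fun i : ℕ =>
            symT X Y (k : M × N).1⁻¹
              ((Y.act (pullbackHom X Y (k ^ (1 - (q : ℤ) + (i : ℤ)))) (k' : M × N).2) ^ i)).prod *
          symB X Y k')⁻¹)
  /-- `[{k}, {k'}] = π₁k^q ⊗ π₂k'^q` -/
  | comm (k k' : pullback X Y) : QTensorRel q X Y
      (symB X Y k * symB X Y k' * (symB X Y k)⁻¹ * (symB X Y k')⁻¹ *
        (symT X Y ((k : M × N).1 ^ q) ((k' : M × N).2 ^ q))⁻¹)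
  /-- `{(m ⁿm⁻¹, ᵐn n⁻¹)} = (m ⊗ n)^q` -/
  | pow (m : M) (n : N) : QTensorRel q X Y
      (symB X Y (pullbackComm X Y m n) * (symT X Y m n ^ q)⁻¹)

/-- The tensor product modulo `q`, `M ⊗^q N`, of two crossed modules `M → P` and `N → P`. -/
abbrev QTensor (q : ℕ) (X : CrossedModule M P) (Y : CrossedModule N P) : Type (max u v) :=
  PresentedGroup {r | QTensorRel q X Y r}

end CrossedModule

/-! ### Powerful `p`-groups -/

/-- `H^n`: the subgroup generated by the `n`-th powers of the elements of `H`. -/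
def Subgroup.nthPowers {G : Type u} [Group G] (H : Subgroup G) (n : ℕ) : Subgroup G :=
  Subgroup.closure {y | ∃ x ∈ H, y = x ^ n}

/-- A subgroup `N` of a finite `p`-group `G` is powerfully embedded in `G` if it is normal and
`[N, G] ≤ N^p` for odd `p`, `[N, G] ≤ N^4` for `p = 2`. -/
def PowerfullyEmbedded (p : ℕ) {G : Type u} [Group G] (N : Subgroup G) : Prop :=
  N.Normal ∧ ⁅N, (⊤ : Subgroup G)⁆ ≤ N.nthPowers (if p = 2 then 4 else p)

/-- A finite `p`-group `G` is powerful if `[G, G] ≤ G^p` for odd `p`, `[G, G] ≤ G^4` for `p = 2`. -/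
def Powerful (p : ℕ) (G : Type u) [Group G] : Prop :=
  ⁅(⊤ : Subgroup G), (⊤ : Subgroup G)⁆ ≤ (⊤ : Subgroup G).nthPowers (if p = 2 then 4 else p)

namespace CrossedModule

variable {M : Type u} {G : Type w} [Group M] [Group G]

theorem act_mem_nthPowers (X : CrossedModule M G) (n : ℕ) (g : G) :
    ∀ m ∈ (⊤ : Subgroup M).nthPowers n, X.act g m ∈ (⊤ : Subgroup M).nthPowers n := by
  intro m hm
  induction hm using Subgroup.closure_induction with
  | mem x hx =>
    obtain ⟨y, _, rfl⟩ := hx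
    exact Subgroup.subset_closure ⟨X.act g y, Subgroup.mem_top _, by simp⟩
  | one => simp
  | mul x y _ _ hx hy => rw [map_mul]; exact mul_mem hx hy
  | inv x _ hx => rw [map_inv]; exact inv_mem hx

/-- The restriction `M^n → G` of a crossed module `M → G`. -/
def powersModule (X : CrossedModule M G) (n : ℕ) :
    CrossedModule ((⊤ : Subgroup M).nthPowers n) G :=
  X.restrict ((⊤ : Subgroup M).nthPowers n) (X.act_mem_nthPowers n)

/-- The natural homomorphism `τ : M^n ⊗ G → M ⊗ G`, where `G → G` is the identity. -/
def tensorPowers (X : CrossedModule M G) (n : ℕ) :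
    Tensor (X.powersModule n) (identity G) →* Tensor X (identity G) :=
  Tensor.mapLeft (identity G) ((⊤ : Subgroup M).nthPowers n).subtype (fun _ => rfl) (fun _ _ => rfl)

end CrossedModule

open scoped commutatorElement

/-! Write `T = M ⊗ G`, with its diagonal `G`-action and the boundary `∂ : T → G`, `m ⊗ g ↦ [μ(m),
g]`. Conjugation by `s` in `T` is the action of `∂(s)`, so `ker ∂` is central and the centre of `T`
has `p`-power index. By Schur's theorem `[T, T]` is then a finite `p`-group. An averaging argument
bounds the exponent of the finitely generated abelianization, and so `T` is a finite `p`-group.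

Let `R` (`powersTensor`) be generated by the `m ⊗ g` with `m ∈ M^p` or `g ∈ μ(M)^p`. Everything
reduces to `R ≤ T^p` (`powersTensor_le_nthPowers`). Indeed `R` contains the image of `M^p ⊗ G`. It
contains `[T, T]`, because `[m ⊗ g, m' ⊗ g'] = (m ᵍm⁻¹) ⊗ [μ(m'), g']`. The remaining commutators of
generators of `M ⊗^p G` also come from `R`: they are `k₁^p ⊗ [μ(m), g]` and `k₁^p ⊗ k'₂^p`, where `k
= (k₁, k₂)`.

For `R ≤ T^p`, the finite `p`-group `Γ = T ⋊ G` is nilpotent, so `R ≤ [R, Γ] T^p` suffices. Modulo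
the right side `Γ` centralizes `R` and `p`-th powers in `T` vanish. With `t = m ⊗ g`, the element `c
= m ⊗ [μ(m), g]` lies in `R` and `ᵐt = ct`, whence `m^n ⊗ g = c^(n choose 2) t^n`. At `n = p` this
is trivial, since an odd `p` divides `p choose 2`. The generators `m ⊗ y^p` with `y ∈ μ(M)` are
treated in the same way. -/

theorem finite_commutatorSet_of_finiteIndex_center (T : Type*) [Group T]
    [(Subgroup.center T).FiniteIndex] : Finite (commutatorSet T) := by
  refine (Set.finite_range fun x : (T ⧸ Subgroup.center T) × (T ⧸ Subgroup.center T) =>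
    ⁅x.1.out, x.2.out⁆).subset ?_
  rintro _ ⟨s, t, rfl⟩
  refine ⟨(s, t), ?_⟩
  obtain ⟨⟨z, hz⟩, hs⟩ := QuotientGroup.mk_out_eq_mul (Subgroup.center T) s
  obtain ⟨⟨w, hw⟩, ht⟩ := QuotientGroup.mk_out_eq_mul (Subgroup.center T) t
  rw [Subgroup.mem_center_iff] at hz hw
  simp only [hs, ht, commutatorElement_def, mul_inv_rev]
  calc s * z * (t * w) * (z⁻¹ * s⁻¹) * (w⁻¹ * t⁻¹)
      = s * (z * (t * w)) * (z⁻¹ * s⁻¹) * (w⁻¹ * t⁻¹) := by group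
    _ = s * t * (w * s⁻¹) * w⁻¹ * t⁻¹ := by rw [← hz]; group
    _ = s * t * s⁻¹ * t⁻¹ := by rw [← hw]; group

theorem IsPGroup.of_quotient {p : ℕ} {T : Type*} [Group T] {N : Subgroup T} [N.Normal]
    (hN : IsPGroup p N) (hT : IsPGroup p (T ⧸ N)) : IsPGroup p T := by
  intro t
  obtain ⟨a, ha⟩ := hT t
  rw [← QuotientGroup.mk_pow, QuotientGroup.eq_one_iff] at ha
  obtain ⟨b, hb⟩ := hN ⟨_, ha⟩
  exact ⟨a + b, by rw [pow_add, pow_mul]; exact congrArg Subtype.val hb⟩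

/-! ### Calculus in `M ⊗ G`: diagonal action, boundary and commutator identities. -/

namespace CrossedModule

section TensorIdentity

variable {M : Type u} {G : Type w} [Group M] [Group G] (X : CrossedModule M G)

/-- The tensor product `M ⊗ G` of a crossed module `M → G` with the identity crossed module. -/
abbrev TensorId : Type (max u w) := X.Tensor (identity G)

/-- The generator `m ⊗ g` of `M ⊗ G`. -/
def tm (m : M) (g : G) : X.TensorId := tmul X (identity G) m g

theorem tm_mul_right (m : M) (g g' : G) :
    X.tm m (g * g') = X.tm m g * X.tm (X.act g m) (g * g' * g⁻¹) :=
  tmul_mul X (identity G) m g g'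

theorem tm_mul_left (m m' : M) (g : G) :
    X.tm (m * m') g =
      X.tm (m * m' * m⁻¹) (X.toHom m * g * (X.toHom m)⁻¹) * X.tm m g := by
  have h := mul_tmul X (identity G) m m' g
  rw [X.act_toHom] at h
  exact h

/-- A homomorphism out of `M ⊗ G` from a map compatible with the defining relations. -/
def liftTensor {H : Type*} [Group H] (f : M → G → H)
    (hr : ∀ m g g', f m (g * g') = f m g * f (X.act g m) (g * g' * g⁻¹))
    (hl : ∀ m m' g, f (m * m') g =
      f (m * m' * m⁻¹) (X.toHom m * g * (X.toHom m)⁻¹) * f m g) : X.TensorId →* H :=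
  PresentedGroup.toGroup (f := fun x : M × G => f x.1 x.2) (by
    rintro r (⟨m, n, n'⟩ | ⟨m, m', n⟩)
    · simp only [map_mul, map_inv, FreeGroup.lift_apply_of]
      rw [hr]
      exact mul_inv_cancel _
    · simp only [map_mul, map_inv, FreeGroup.lift_apply_of]
      rw [hl, X.act_toHom]
      exact mul_inv_cancel _)

@[simp]
theorem liftTensor_tm {H : Type*} [Group H] (f : M → G → H) (hr) (hl) (m : M) (g : G) :
    X.liftTensor f hr hl (X.tm m g) = f m g :=
  PresentedGroup.toGroup.of _

variable {X} in
theorem tensor_hom_ext {H : Type*} [Group H] {φ ψ : X.TensorId →* H}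
    (h : ∀ m g, φ (X.tm m g) = ψ (X.tm m g)) : φ = ψ :=
  PresentedGroup.ext fun x => h x.1 x.2

theorem mem_of_tm_mem (H : Subgroup X.TensorId) (h : ∀ m g, X.tm m g ∈ H) (t : X.TensorId) :
    t ∈ H :=
  PresentedGroup.generated_by _ H (fun x => h x.1 x.2) t

/-- The action of an element of `G` on `M ⊗ G`, as an endomorphism. -/
def tensorEnd (x : G) : X.TensorId →* X.TensorId :=
  X.liftTensor (fun m g => X.tm (X.act x m) (x * g * x⁻¹))
    (fun m g g' => by
      have h : x * (g * g') * x⁻¹ = (x * g * x⁻¹) * (x * g' * x⁻¹) := by group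
      rw [h, tm_mul_right]
      congr 2
      · rw [← MulAut.mul_apply, ← MulAut.mul_apply, ← map_mul, ← map_mul]
        congr 2
        group
      · group)
    (fun m m' g => by
      rw [map_mul, tm_mul_left, X.toHom_act]
      congr 2
      · simp
      · group)

@[simp]
theorem tensorEnd_tm (x : G) (m : M) (g : G) :
    X.tensorEnd x (X.tm m g) = X.tm (X.act x m) (x * g * x⁻¹) :=
  liftTensor_tm ..

theorem tensorEnd_mul (x y : G) : X.tensorEnd (x * y) = (X.tensorEnd x).comp (X.tensorEnd y) :=
  tensor_hom_ext fun m g => by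
    simp only [MonoidHom.comp_apply, tensorEnd_tm, map_mul, MulAut.mul_apply]
    congr 1
    group

theorem tensorEnd_one : X.tensorEnd 1 = MonoidHom.id _ :=
  tensor_hom_ext fun m g => by simp

/-- The diagonal action of `G` on `M ⊗ G`. -/
def tensorAct : G →* MulAut X.TensorId where
  toFun x := MonoidHom.toMulEquiv (X.tensorEnd x) (X.tensorEnd x⁻¹)
    (by rw [← tensorEnd_mul, inv_mul_cancel, tensorEnd_one])
    (by rw [← tensorEnd_mul, mul_inv_cancel, tensorEnd_one])
  map_one' := MulEquiv.ext fun t => DFunLike.congr_fun X.tensorEnd_one t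
  map_mul' x y := MulEquiv.ext fun t => DFunLike.congr_fun (X.tensorEnd_mul x y) t

@[simp]
theorem tensorAct_tm (x : G) (m : M) (g : G) :
    X.tensorAct x (X.tm m g) = X.tm (X.act x m) (x * g * x⁻¹) :=
  X.tensorEnd_tm x m g

theorem tensorAct_mul_apply (x y : G) (t : X.TensorId) :
    X.tensorAct (x * y) t = X.tensorAct x (X.tensorAct y t) := by
  rw [map_mul, MulAut.mul_apply]

theorem tm_mul (m : M) (g g' : G) :
    X.tm m (g * g') = X.tm m g * X.tensorAct g (X.tm m g') := by
  rw [tm_mul_right, tensorAct_tm]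

theorem mul_tm (m m' : M) (g : G) :
    X.tm (m * m') g = X.tensorAct (X.toHom m) (X.tm m' g) * X.tm m g := by
  rw [tm_mul_left, tensorAct_tm, X.act_toHom]

@[simp]
theorem tm_one (m : M) : X.tm m 1 = 1 := by
  have h := X.tm_mul m 1 1
  rw [map_one, MulAut.one_apply, mul_one] at h
  exact left_eq_mul.mp h

@[simp]
theorem one_tm (g : G) : X.tm 1 g = 1 := by
  have h := X.mul_tm 1 1 g
  rw [map_one, map_one, MulAut.one_apply, mul_one] at h
  exact left_eq_mul.mp h

theorem tensorAct_tm_inv (m : M) (g : G) :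
    X.tensorAct g (X.tm m g⁻¹) = (X.tm m g)⁻¹ := by
  have h := X.tm_mul m g g⁻¹
  rw [mul_inv_cancel, tm_one] at h
  exact (inv_eq_of_mul_eq_one_right h.symm).symm

theorem tensorAct_inv_tm (m : M) (g : G) :
    X.tensorAct (X.toHom m) (X.tm m⁻¹ g) = (X.tm m g)⁻¹ := by
  have h := X.mul_tm m m⁻¹ g
  rw [mul_inv_cancel, one_tm] at h
  exact (inv_eq_of_mul_eq_one_left h.symm).symm

/-- The homomorphism `M ⊗ G → G`, `m ⊗ g ↦ [μ(m), g]`. -/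
def boundary : X.TensorId →* G :=
  X.liftTensor (fun m g => ⁅X.toHom m, g⁆)
    (fun m g g' => by simp only [toHom_act, commutatorElement_def]; group)
    (fun m m' g => by simp only [map_mul, map_inv, commutatorElement_def]; group)

@[simp]
theorem boundary_tm (m : M) (g : G) : X.boundary (X.tm m g) = ⁅X.toHom m, g⁆ :=
  liftTensor_tm ..

/-- On a generator `t = m' ⊗ g'` this compares the two expansions of `mm' ⊗ gg'`, splitting the left
or the right factor first, and cancels the common outer terms. -/
theorem tm_mul_tensorAct (m : M) (g : G) (t : X.TensorId) :
    X.tm m g * X.tensorAct (g * X.toHom m) t = X.tensorAct (X.toHom m * g) t * X.tm m g := by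
  have key : (MulAut.conj (X.tm m g)).toMonoidHom.comp
      (X.tensorAct (g * X.toHom m)).toMonoidHom = (X.tensorAct (X.toHom m * g)).toMonoidHom := by
    refine tensor_hom_ext fun m' g' => ?_
    have h₁ := X.tm_mul (m * m') g g'
    have h₂ := X.mul_tm m m' (g * g')
    rw [h₂, mul_tm X m m' g, mul_tm X m m' g', tm_mul, tm_mul, map_mul, map_mul] at h₁
    simp only [← tensorAct_mul_apply, mul_assoc] at h₁
    have h₃ := mul_left_cancel h₁
    rw [← mul_assoc, ← mul_assoc] at h₃
    have h₄ := mul_right_cancel h₃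
    change X.tm m g * X.tensorAct (g * X.toHom m) (X.tm m' g') * (X.tm m g)⁻¹ =
      X.tensorAct (X.toHom m * g) (X.tm m' g')
    rw [← h₄, mul_inv_cancel_right]
  have h := DFunLike.congr_fun key t
  change X.tm m g * X.tensorAct (g * X.toHom m) t * (X.tm m g)⁻¹ = _ at h
  exact mul_inv_eq_iff_eq_mul.mp h

theorem conj_eq_tensorAct_boundary : MulAut.conj = X.tensorAct.comp X.boundary :=
  tensor_hom_ext fun m g => MulEquiv.ext fun t => by
    have h := X.tm_mul_tensorAct m g (X.tensorAct (g * X.toHom m)⁻¹ t)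
    rw [← tensorAct_mul_apply, ← tensorAct_mul_apply, mul_inv_cancel, map_one,
      MulAut.one_apply] at h
    rw [MulAut.conj_apply, h, mul_inv_cancel_right, MonoidHom.comp_apply, boundary_tm,
      commutatorElement_def]
    congr 2
    group

theorem mul_mul_inv_eq_tensorAct (s t : X.TensorId) :
    s * t * s⁻¹ = X.tensorAct (X.boundary s) t :=
  DFunLike.congr_fun (DFunLike.congr_fun X.conj_eq_tensorAct_boundary s) t

/-- `m ⊗ [μ(m'), g] = ᵐ(m' ⊗ g) (m' ⊗ g)⁻¹`. -/
theorem tm_commutator (m m' : M) (g : G) :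
    X.tm m ⁅X.toHom m', g⁆ = X.tensorAct (X.toHom m) (X.tm m' g) * (X.tm m' g)⁻¹ := by
  have h₁ : X.tm m ⁅X.toHom m', g⁆ = X.tm m (X.toHom m' * g * (X.toHom m')⁻¹) *
      (X.tensorAct ⁅X.toHom m', g⁆ (X.tm m g))⁻¹ := by
    have h := X.tm_mul m (X.toHom m' * g * (X.toHom m')⁻¹) g⁻¹
    have h' : X.tm m g⁻¹ = X.tensorAct g⁻¹ (X.tm m g)⁻¹ := by
      rw [← tensorAct_tm_inv, ← tensorAct_mul_apply, inv_mul_cancel, map_one, MulAut.one_apply]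
    rw [h', ← tensorAct_mul_apply, map_inv] at h
    exact h
  have h₂ : X.tensorAct (X.toHom m) (X.tm m' g) * X.tm m g =
      X.tm m (X.toHom m' * g * (X.toHom m')⁻¹) * X.tm m' g := by
    rw [← mul_tm]
    have h := X.mul_tm m' (m'⁻¹ * m * m') g
    rw [tensorAct_tm, X.act_toHom] at h
    have e₁ : m' * (m'⁻¹ * m * m') = m * m' := by group
    have e₂ : m' * (m'⁻¹ * m * m') * m'⁻¹ = m := by group
    rw [e₂, e₁] at h
    exact h
  rw [h₁, ← boundary_tm, ← mul_mul_inv_eq_tensorAct, eq_mul_inv_of_mul_eq h₂]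
  group

/-- `(m ʰm⁻¹) ⊗ g = (m ⊗ h) ᵍ(m ⊗ h)⁻¹`. -/
theorem mul_act_inv_tm (m : M) (h g : G) :
    X.tm (m * X.act h m⁻¹) g = X.tm m h * (X.tensorAct g (X.tm m h))⁻¹ := by
  have h₁ : X.tm (X.act h m⁻¹) g =
      (X.tensorAct (h * (X.toHom m)⁻¹) (X.tm m (h⁻¹ * g * h)))⁻¹ := by
    rw [← map_inv, ← tensorAct_inv_tm, ← tensorAct_mul_apply, tensorAct_tm]
    congr 1
    · simp
    · group
  have h₂ : X.tm m h * X.tensorAct h (X.tm m (h⁻¹ * g * h)) =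
      X.tm m g * X.tensorAct g (X.tm m h) := by
    rw [← tm_mul, ← tm_mul]
    congr 1
    group
  have h₃ : X.toHom m * (h * (X.toHom m)⁻¹) = ⁅X.toHom m, h⁆ * h := by
    rw [commutatorElement_def]; group
  rw [mul_tm, h₁, map_inv, ← tensorAct_mul_apply, h₃, tensorAct_mul_apply, ← boundary_tm,
    ← mul_mul_inv_eq_tensorAct, h₂]
  group

/-! ### Finiteness -/

theorem ker_boundary_le_center : X.boundary.ker ≤ Subgroup.center X.TensorId := by
  intro s hs
  rw [Subgroup.mem_center_iff]
  intro t
  have h := X.mul_mul_inv_eq_tensorAct s t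
  rw [MonoidHom.mem_ker.mp hs, map_one, MulAut.one_apply] at h
  exact (mul_inv_eq_iff_eq_mul.mp h).symm

/-- Averaging twice. The product `P m` over all `g` satisfies `P m = f m g ^ |G| * φ g (P m)`. The
product `B` of all `P m` is `G`-invariant and satisfies `B = φ (μ m) B * P m ^ |M|`, so `P m ^ |M| =
1`. Raising the first relation to the power `|M|` gives the claim. -/
theorem abelianization_of_tm_pow [Finite M] [Finite G] (m : M) (g : G) :
    Abelianization.of (X.tm m g) ^ (Nat.card G * Nat.card M) = 1 := by
  cases nonempty_fintype M
  cases nonempty_fintype G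
  let f (m : M) (g : G) : Abelianization X.TensorId := Abelianization.of (X.tm m g)
  let φ (x : G) : Abelianization X.TensorId →* Abelianization X.TensorId :=
    Abelianization.map (X.tensorAct x).toMonoidHom
  have hφ (x : G) (t) : φ x (Abelianization.of t) = Abelianization.of (X.tensorAct x t) :=
    Abelianization.map_of _ _
  have hφf (x : G) (m : M) (g : G) : φ x (f m g) = f (X.act x m) (x * g * x⁻¹) := by
    simp only [f, hφ, tensorAct_tm]
  have hr (m : M) (g g' : G) : f m (g * g') = f m g * φ g (f m g') := by
    simp only [f, tm_mul, map_mul, hφ]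
  have hl (m m' : M) (g : G) : f (m * m') g = φ (X.toHom m) (f m' g) * f m g := by
    simp only [f, mul_tm, map_mul, hφ]
  let P (m : M) := ∏ g, f m g
  have hP (m : M) (g : G) : P m = f m g ^ Nat.card G * φ g (P m) := by
    simp only [P, map_prod]
    rw [← Equiv.prod_comp (Equiv.mulLeft g)]
    simp [hr, Finset.prod_mul_distrib, Nat.card_eq_fintype_card]
  have hPl (m m' : M) : P (m * m') = φ (X.toHom m) (P m') * P m := by
    simp only [P, map_prod, hl, Finset.prod_mul_distrib]
  let B := ∏ m, P m
  have hB (x : G) : φ x B = B := by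
    simp only [B, P, map_prod, hφf]
    refine (Equiv.prod_comp (X.act x).toEquiv fun m => ∏ g, f m (x * g * x⁻¹)).trans ?_
    exact Finset.prod_congr rfl fun m _ =>
      Equiv.prod_comp (MulAut.conj x).toEquiv fun g => f m g
  have hPM (m : M) : P m ^ Nat.card M = 1 := by
    have h : B = φ (X.toHom m) B * P m ^ Nat.card M := by
      simp only [B, map_prod]
      conv_lhs => rw [← Equiv.prod_comp (Equiv.mulLeft m)]
      simp [hPl, Finset.prod_mul_distrib, Nat.card_eq_fintype_card]
    rw [hB] at h
    exact left_eq_mul.mp h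
  have h := congrArg (· ^ Nat.card M) (hP m g)
  simp only [mul_pow, ← map_pow, hPM, map_one, mul_one, ← pow_mul] at h
  exact h.symm

theorem abelianization_pow [Finite M] [Finite G] (a : Abelianization X.TensorId) :
    a ^ (Nat.card G * Nat.card M) = 1 := by
  obtain ⟨t, rfl⟩ := QuotientGroup.mk_surjective a
  exact X.mem_of_tm_mem ((powMonoidHom (Nat.card G * Nat.card M)).comp Abelianization.of).ker
    X.abelianization_of_tm_pow t

theorem exists_index_center_eq_pow [Finite G] {p : ℕ} [Fact p.Prime] (hG : IsPGroup p G) :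
    ∃ n, (Subgroup.center X.TensorId).index = p ^ n := by
  obtain ⟨n, hn⟩ := IsPGroup.iff_card.mp (hG.to_subgroup X.boundary.range)
  rw [← Subgroup.index_ker] at hn
  have h := Subgroup.index_dvd_of_le X.ker_boundary_le_center
  rw [hn, Nat.dvd_prime_pow Fact.out] at h
  exact ⟨_, h.choose_spec.2⟩

theorem finite_isPGroup_tensorId [Finite M] [Finite G] {p : ℕ} [Fact p.Prime]
    (hM : IsPGroup p M) (hG : IsPGroup p G) :
    Finite X.TensorId ∧ IsPGroup p X.TensorId := by
  obtain ⟨n, hn⟩ := X.exists_index_center_eq_pow hG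
  have hp : p.Prime := Fact.out
  have : (Subgroup.center X.TensorId).FiniteIndex :=
    ⟨by rw [hn]; exact (Nat.pow_pos hp.pos).ne'⟩
  have := finite_commutatorSet_of_finiteIndex_center X.TensorId
  -- Quantitative Schur: the order of the derived subgroup divides a power of the index of the
  -- centre, here a power of `p`.
  have hdvd := Subgroup.card_commutator_dvd_index_center_pow X.TensorId
  rw [hn, ← pow_mul] at hdvd
  have hcomm : IsPGroup p (commutator X.TensorId) := IsPGroup.of_card_dvd_pow hdvd
  obtain ⟨a, ha⟩ := IsPGroup.iff_card.mp hG
  obtain ⟨b, hb⟩ := IsPGroup.iff_card.mp hM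
  have hab (x : X.TensorId ⧸ commutator X.TensorId) : x ^ p ^ (a + b) = 1 := by
    have h := X.abelianization_pow x
    rwa [ha, hb, ← pow_add] at h
  have hfg : Group.FG X.TensorId :=
    ⟨⟨(Set.finite_range fun x : M × G => X.tm x.1 x.2).toFinset, eq_top_iff.mpr fun t _ =>
      X.mem_of_tm_mem _ (fun m g => Subgroup.subset_closure (by simp)) t⟩⟩
  have : Group.FG (Abelianization X.TensorId) := QuotientGroup.fg (commutator X.TensorId)
  have : Finite (Abelianization X.TensorId) :=
    CommGroup.finite_of_fg_isMulTorsion _ fun x =>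
      isOfFinOrder_iff_pow_eq_one.mpr ⟨p ^ (a + b), Nat.pow_pos hp.pos, hab x⟩
  have : Finite (X.TensorId ⧸ commutator X.TensorId) := this
  exact ⟨Finite.of_subgroup_quotient (commutator X.TensorId),
    hcomm.of_quotient fun x => ⟨a + b, hab x⟩⟩

end TensorIdentity

end CrossedModule

/-! ### Nilpotency, power subgroups and a collection formula. -/

/-- Modulo `V` the image of `R` satisfies `R ≤ [R, T]`, so it lies in every term of the lower
central series, and the last of these is trivial. -/
theorem le_of_le_commutator_top_sup {T : Type*} [Group T] [Group.IsNilpotent T]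
    {R V : Subgroup T} [V.Normal] (h : R ≤ ⁅R, (⊤ : Subgroup T)⁆ ⊔ V) : R ≤ V := by
  let f := QuotientGroup.mk' V
  have h₁ : R.map f ≤ ⁅R.map f, (⊤ : Subgroup (T ⧸ V))⁆ := by
    refine (Subgroup.map_mono h).trans ?_
    rw [Subgroup.map_sup, Subgroup.map_commutator, QuotientGroup.map_mk'_self, sup_bot_eq]
    exact Subgroup.commutator_mono le_rfl le_top
  have h₂ (n : ℕ) : R.map f ≤ (⊤ : Subgroup (T ⧸ V)).lowerCentralSeries n := by
    induction n with
    | zero => exact le_top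
    | succ n ih =>
      rw [Subgroup.lowerCentralSeries_succ]
      exact h₁.trans (Subgroup.commutator_mono ih le_rfl)
  obtain ⟨n, hn⟩ := Subgroup.nilpotent_iff_lowerCentralSeries.mp
    (inferInstance : Group.IsNilpotent (T ⧸ V))
  have h₃ := h₂ n
  rw [hn, le_bot_iff, Subgroup.map_eq_bot_iff, QuotientGroup.ker_mk'] at h₃
  exact h₃

theorem Subgroup.pow_mem_nthPowers {T : Type*} [Group T] {H : Subgroup T} {n : ℕ} {x : T}
    (hx : x ∈ H) : x ^ n ∈ H.nthPowers n :=
  Subgroup.subset_closure ⟨x, hx, rfl⟩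

theorem Subgroup.map_mem_nthPowers {T T' : Type*} [Group T] [Group T'] {H : Subgroup T}
    {H' : Subgroup T'} {n : ℕ} (f : T →* T') (hf : ∀ x ∈ H, f x ∈ H') {x : T}
    (hx : x ∈ H.nthPowers n) : f x ∈ H'.nthPowers n := by
  have h : H.nthPowers n ≤ (H'.nthPowers n).comap f := by
    refine (Subgroup.closure_le _).mpr ?_
    rintro _ ⟨y, hy, rfl⟩
    rw [SetLike.mem_coe, Subgroup.mem_comap, map_pow]
    exact pow_mem_nthPowers (hf y hy)
  exact h hx

instance Subgroup.nthPowers_normal {T : Type*} [Group T] (H : Subgroup T) [H.Normal] (n : ℕ) :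
    (H.nthPowers n).Normal :=
  ⟨fun _ hx g => map_mem_nthPowers (MulAut.conj g).toMonoidHom
    (fun y hy => Subgroup.Normal.conj_mem inferInstance y hy g) hx⟩

/-- The exponent of `c` is `0 + 1 + ⋯ + (n - 1)`. Both orders of multiplication are allowed because
`m^n ⊗ g` grows on the left and `m ⊗ y^n` on the right. -/
theorem eq_pow_choose_two_mul_pow {T : Type*} [Group T] {c t : T} (h : Commute c t) (a : ℕ → T)
    (h₀ : a 0 = 1)
    (hs : ∀ n, a (n + 1) = c ^ n * t * a n ∨ a (n + 1) = a n * (c ^ n * t)) (n : ℕ) :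
    a n = c ^ n.choose 2 * t ^ n := by
  induction n with
  | zero => simp [h₀]
  | succ n ih =>
    have e : c ^ (n + 1).choose 2 * t ^ (n + 1) = c ^ n * t * (c ^ n.choose 2 * t ^ n) := by
      rw [Nat.choose_succ_succ' n 1, Nat.choose_one_right, pow_add, pow_succ', mul_assoc,
        ← mul_assoc (c ^ n.choose 2), (h.pow_left _).eq]
      simp only [mul_assoc]
    have hc : Commute (c ^ n * t) (c ^ n.choose 2 * t ^ n) :=
      ((Commute.refl c).pow_pow _ _ |>.mul_left (h.symm.pow_right _)).mul_right
        ((h.pow_pow _ _).mul_left ((Commute.refl t).pow_right _))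
    rcases hs n with hn | hn
    · rw [hn, ih, e]
    · rw [hn, ih, e, hc.eq]

/-! ### The inclusion of `powersTensor` in the subgroup of `p`-th powers. -/

namespace CrossedModule

section TensorIdentity

variable {M : Type u} {G : Type w} [Group M] [Group G] (X : CrossedModule M G)

theorem range_normal : X.toHom.range.Normal :=
  ⟨by
    rintro _ ⟨m, rfl⟩ g
    exact ⟨X.act g m, X.toHom_act g m⟩⟩

/-- The subgroup of `M ⊗ G` generated by the images of `Mⁿ ⊗ G` and `M ⊗ μ(M)ⁿ`. -/
def powersTensor (n : ℕ) : Subgroup X.TensorId :=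
  Subgroup.closure ({t | ∃ m ∈ (⊤ : Subgroup M).nthPowers n, ∃ g, X.tm m g = t} ∪
    {t | ∃ m, ∃ g ∈ X.toHom.range.nthPowers n, X.tm m g = t})

variable {X} {p : ℕ}

theorem tm_mem_powersTensor_left {m : M} (hm : m ∈ (⊤ : Subgroup M).nthPowers p) (g : G) :
    X.tm m g ∈ X.powersTensor p :=
  Subgroup.subset_closure (Or.inl ⟨m, hm, g, rfl⟩)

theorem tm_mem_powersTensor_right (m : M) {g : G} (hg : g ∈ X.toHom.range.nthPowers p) :
    X.tm m g ∈ X.powersTensor p :=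
  Subgroup.subset_closure (Or.inr ⟨m, g, hg, rfl⟩)

theorem tensorAct_mem_powersTensor (x : G) {t : X.TensorId} (ht : t ∈ X.powersTensor p) :
    X.tensorAct x t ∈ X.powersTensor p := by
  have := X.range_normal
  have h : X.powersTensor p ≤ (X.powersTensor p).comap (X.tensorAct x).toMonoidHom := by
    refine (Subgroup.closure_le _).mpr ?_
    rintro _ (⟨m, hm, g, rfl⟩ | ⟨m, g, hg, rfl⟩)
    · change X.tensorAct x (X.tm m g) ∈ X.powersTensor p
      rw [tensorAct_tm]
      exact tm_mem_powersTensor_left (X.act_mem_nthPowers p x m hm) _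
    · change X.tensorAct x (X.tm m g) ∈ X.powersTensor p
      rw [tensorAct_tm]
      exact tm_mem_powersTensor_right _ (Subgroup.Normal.conj_mem inferInstance g hg x)
  exact h ht

section Quotient

variable {W : Subgroup X.TensorId} [W.Normal]

theorem mk_tensorAct_pow
    (hR : ∀ x, ∀ r ∈ X.powersTensor p, X.tensorAct x r * r⁻¹ ∈ W) {x : G} {t c : X.TensorId}
    (hc : c ∈ X.powersTensor p) (ht : X.tensorAct x t = c * t) (n : ℕ) :
    (X.tensorAct (x ^ n) t : X.TensorId ⧸ W) = (c : X.TensorId ⧸ W) ^ n * (t : X.TensorId ⧸ W) := by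
  have hact (y : G) : (X.tensorAct y c : X.TensorId ⧸ W) = c :=
    QuotientGroup.eq_iff_div_mem.mpr (by rw [div_eq_mul_inv]; exact hR y c hc)
  induction n with
  | zero => simp
  | succ n ih =>
    rw [pow_succ, tensorAct_mul_apply, ht, map_mul, QuotientGroup.mk_mul, hact, ih, pow_succ',
      mul_assoc]

theorem mem_of_succ_eq (hp : p.Prime) (hodd : Odd p)
    (hpow : (⊤ : Subgroup X.TensorId).nthPowers p ≤ W)
    (hR : ∀ x, ∀ r ∈ X.powersTensor p, X.tensorAct x r * r⁻¹ ∈ W) {x : G} {t c : X.TensorId}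
    (hc : c ∈ X.powersTensor p) (ht : X.tensorAct x t = c * t) (a : ℕ → X.TensorId)
    (h₀ : a 0 = 1)
    (hs : ∀ n, a (n + 1) = X.tensorAct (x ^ n) t * a n ∨
      a (n + 1) = a n * X.tensorAct (x ^ n) t) : a p ∈ W := by
  have hq (s : X.TensorId) : (s : X.TensorId ⧸ W) ^ p = 1 := by
    rw [← QuotientGroup.mk_pow, QuotientGroup.eq_one_iff]
    exact hpow (Subgroup.pow_mem_nthPowers (Subgroup.mem_top s))
  -- Conjugation by `t` is the action of its boundary, which fixes `c` modulo `W`.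
  have hcomm : Commute (c : X.TensorId ⧸ W) (t : X.TensorId ⧸ W) := by
    have h := hR (X.boundary t) c hc
    rw [← mul_mul_inv_eq_tensorAct, ← div_eq_mul_inv, ← QuotientGroup.eq_iff_div_mem] at h
    rw [QuotientGroup.mk_mul, QuotientGroup.mk_mul, QuotientGroup.mk_inv,
      mul_inv_eq_iff_eq_mul] at h
    exact h.symm
  have h := eq_pow_choose_two_mul_pow hcomm (fun n => (a n : X.TensorId ⧸ W)) (by simp [h₀])
    (fun n => by
      rcases hs n with hn | hn
      · left
        rw [hn, QuotientGroup.mk_mul, mk_tensorAct_pow hR hc ht]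
      · right
        rw [hn, QuotientGroup.mk_mul, mk_tensorAct_pow hR hc ht]) p
  have h2 : p ≠ 2 := by rintro rfl; exact absurd hodd (by decide)
  obtain ⟨k, hk⟩ := hp.dvd_choose_self (k := 2) two_ne_zero (lt_of_le_of_ne hp.two_le h2.symm)
  simp only [hk, pow_mul, hq, one_pow, mul_one] at h
  exact (QuotientGroup.eq_one_iff _).mp h

/-- The two hypotheses cross over: the embedding of `μ(M)` puts the correction term `c` for `m^p ⊗
g` in the second family of generators of `powersTensor`, while powerfulness of `M` puts the one for
`m ⊗ y^p` in the first. Invariance of `W` under `G` then passes from `p`-th powers to the subgroups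
they generate. -/
theorem powersTensor_le_of_tensorAct_trivial (hp : p.Prime) (hodd : Odd p)
    (hM : commutator M ≤ (⊤ : Subgroup M).nthPowers p)
    (hG : ⁅X.toHom.range, (⊤ : Subgroup G)⁆ ≤ X.toHom.range.nthPowers p)
    (hW : ∀ x, ∀ t ∈ W, X.tensorAct x t ∈ W)
    (hpow : (⊤ : Subgroup X.TensorId).nthPowers p ≤ W)
    (hR : ∀ x, ∀ r ∈ X.powersTensor p, X.tensorAct x r * r⁻¹ ∈ W) :
    X.powersTensor p ≤ W := by
  refine (Subgroup.closure_le _).mpr ?_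
  rintro _ (⟨m, hm, g, rfl⟩ | ⟨m, g, hg, rfl⟩)
  · induction hm using Subgroup.closure_induction generalizing g with
    | mem x hx =>
      obtain ⟨m, _, rfl⟩ := hx
      refine mem_of_succ_eq hp hodd hpow hR (x := X.toHom m) (t := X.tm m g)
        (c := X.tm m ⁅X.toHom m, g⁆) (tm_mem_powersTensor_right _ (hG
          (Subgroup.commutator_mem_commutator ⟨m, rfl⟩ (Subgroup.mem_top g)))) ?_
        (fun n => X.tm (m ^ n) g) (by simp) fun n => Or.inl ?_
      · rw [tm_commutator, inv_mul_cancel_right]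
      · rw [pow_succ, mul_tm, map_pow]
    | one => simp
    | mul x y _ _ hx hy =>
      rw [SetLike.mem_coe, mul_tm]
      exact mul_mem (hW _ _ (hy g)) (hx g)
    | inv x _ hx =>
      have h := X.tensorAct_inv_tm x g
      have h' := hW (X.toHom x)⁻¹ _ (inv_mem (hx g))
      rwa [← h, ← tensorAct_mul_apply, inv_mul_cancel, map_one, MulAut.one_apply] at h'
  · induction hg using Subgroup.closure_induction with
    | mem x hx =>
      obtain ⟨_, ⟨y, rfl⟩, rfl⟩ := hx
      have hmy : m * X.act (X.toHom y) m⁻¹ ∈ (⊤ : Subgroup M).nthPowers p := by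
        refine hM ?_
        have h := Subgroup.commutator_mem_commutator (Subgroup.mem_top m) (Subgroup.mem_top y)
        rw [commutatorElement_def] at h
        rw [X.act_toHom, ← mul_assoc, ← mul_assoc]
        exact h
      refine mem_of_succ_eq hp hodd hpow hR (x := X.toHom y) (t := X.tm m (X.toHom y))
        (c := (X.tm (m * X.act (X.toHom y) m⁻¹) (X.toHom y))⁻¹)
        (inv_mem (tm_mem_powersTensor_left hmy _)) ?_
        (fun n => X.tm m (X.toHom y ^ n)) (by simp) fun n => Or.inr ?_
      · rw [mul_act_inv_tm]
        group
      · rw [pow_succ, tm_mul]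
    | one => simp
    | mul x y _ _ hx hy =>
      rw [SetLike.mem_coe, tm_mul]
      exact mul_mem hx (hW _ _ hy)
    | inv x _ hx =>
      have h := X.tensorAct_tm_inv m x
      have h' := hW x⁻¹ _ (inv_mem hx)
      rwa [← h, ← tensorAct_mul_apply, inv_mul_cancel, map_one, MulAut.one_apply] at h'

end Quotient

/-- Invariance under `G` suffices, as conjugation by elements of `M ⊗ G` is itself the action of
elements of `G`. -/
theorem map_inl_normal {H : Subgroup X.TensorId} (hH : ∀ x, ∀ t ∈ H, X.tensorAct x t ∈ H) :
    (H.map (SemidirectProduct.inl : X.TensorId →* X.TensorId ⋊[X.tensorAct] G)).Normal := by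
  refine ⟨?_⟩
  rintro _ ⟨t, ht, rfl⟩ γ
  refine ⟨γ.left * X.tensorAct γ.right t * γ.left⁻¹, ?_, ?_⟩
  · rw [mul_mul_inv_eq_tensorAct]
    exact hH _ _ (hH _ _ ht)
  · conv_rhs => rw [← SemidirectProduct.inl_left_mul_inr_right γ]
    simp [-SemidirectProduct.inl_left_mul_inr_right, SemidirectProduct.inl_aut, mul_assoc]

theorem powersTensor_le_nthPowers [Finite M] [Finite G] [Fact p.Prime] (hodd : Odd p)
    (hpM : IsPGroup p M) (hpG : IsPGroup p G)
    (hM : commutator M ≤ (⊤ : Subgroup M).nthPowers p)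
    (hG : ⁅X.toHom.range, (⊤ : Subgroup G)⁆ ≤ X.toHom.range.nthPowers p) :
    X.powersTensor p ≤ (⊤ : Subgroup X.TensorId).nthPowers p := by
  obtain ⟨hfin, hT⟩ := X.finite_isPGroup_tensorId hpM hpG
  have hfin' : Finite (X.TensorId ⋊[X.tensorAct] G) :=
    Finite.of_equiv _ SemidirectProduct.equivProd.symm
  have hΓ : IsPGroup p (X.TensorId ⋊[X.tensorAct] G) := by
    obtain ⟨a, ha⟩ := IsPGroup.iff_card.mp hT
    obtain ⟨b, hb⟩ := IsPGroup.iff_card.mp hpG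
    exact IsPGroup.of_card (n := a + b) (by rw [SemidirectProduct.card, ha, hb, pow_add])
  have hnil := hΓ.isNilpotent
  let ι : X.TensorId →* X.TensorId ⋊[X.tensorAct] G := SemidirectProduct.inl
  have hι : Function.Injective ι := SemidirectProduct.inl_injective
  have hR : ((X.powersTensor p).map ι).Normal :=
    map_inl_normal fun x _ ht => tensorAct_mem_powersTensor x ht
  have hV : (((⊤ : Subgroup X.TensorId).nthPowers p).map ι).Normal :=
    map_inl_normal fun x _ ht =>
      Subgroup.map_mem_nthPowers (X.tensorAct x).toMonoidHom (fun _ _ => Subgroup.mem_top _) ht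
  -- Commutators are taken with the whole semidirect product, so that dividing by `U` kills the
  -- `G`-action on `powersTensor` as well as its commutators with `M ⊗ G`.
  let U := ⁅(X.powersTensor p).map ι, (⊤ : Subgroup (X.TensorId ⋊[X.tensorAct] G))⁆ ⊔
    ((⊤ : Subgroup X.TensorId).nthPowers p).map ι
  have hU : U.Normal := inferInstance
  have key : X.powersTensor p ≤ U.comap ι := by
    refine powersTensor_le_of_tensorAct_trivial Fact.out hodd hM hG ?_ ?_ ?_
    · intro x t ht
      rw [Subgroup.mem_comap] at ht ⊢
      have h := hU.conj_mem _ ht (SemidirectProduct.inr x)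
      rwa [← map_inv, ← SemidirectProduct.inl_aut] at h
    · exact Subgroup.map_le_iff_le_comap.mp le_sup_right
    · intro x r hr
      refine Subgroup.mem_sup_left ?_
      rw [Subgroup.commutator_comm]
      have h := Subgroup.commutator_mem_commutator
        (Subgroup.mem_top (SemidirectProduct.inr x : X.TensorId ⋊[X.tensorAct] G))
        (Subgroup.mem_map_of_mem ι hr)
      rw [commutatorElement_def, ← map_inv SemidirectProduct.inr x] at h
      rw [map_mul, map_inv]
      change SemidirectProduct.inl (X.tensorAct x r) * _ ∈ _
      rwa [SemidirectProduct.inl_aut]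
  have h := le_of_le_commutator_top_sup (Subgroup.map_le_iff_le_comap.mpr key)
  exact (Subgroup.map_le_map_iff_of_injective hι).mp h

end TensorIdentity

end CrossedModule

/-! ### Commutators of generators, in `M ⊗ G` and modulo `p`. -/

theorem commutator_top_le_of_closure_eq_top {T : Type*} [Group T] {S : Set T}
    (hS : Subgroup.closure S = ⊤) {W : Subgroup T} [W.Normal]
    (h : ∀ a ∈ S, ∀ b ∈ S, ⁅a, b⁆ ∈ W) : ⁅(⊤ : Subgroup T), (⊤ : Subgroup T)⁆ ≤ W := by
  let f := QuotientGroup.mk' W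
  have extend {a : T} (ha : ∀ b ∈ S, ⁅a, b⁆ ∈ W) (b : T) : ⁅a, b⁆ ∈ W := by
    have hle : Subgroup.closure S ≤ (Subgroup.centralizer {f a}).comap f := by
      refine (Subgroup.closure_le _).mpr fun b hb => ?_
      rw [SetLike.mem_coe, Subgroup.mem_comap, Subgroup.mem_centralizer_singleton_iff]
      have h := (QuotientGroup.eq_one_iff _).mpr (ha b hb)
      exact (commutatorElement_eq_one_iff_mul_comm.mp
        ((map_commutatorElement f a b).symm.trans h)).symm
    rw [hS] at hle
    have hb := hle (Subgroup.mem_top b)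
    rw [Subgroup.mem_comap, Subgroup.mem_centralizer_singleton_iff] at hb
    refine (QuotientGroup.eq_one_iff _).mp ((map_commutatorElement f a b).trans ?_)
    exact commutatorElement_eq_one_iff_mul_comm.mpr hb.symm
  refine Subgroup.commutator_le.mpr fun a _ b _ => extend (fun b hb => ?_) b
  rw [← commutatorElement_inv]
  exact inv_mem (extend (h b hb) a)

namespace CrossedModule

section TensorIdentity

variable {M : Type u} {G : Type w} [Group M] [Group G] (X : CrossedModule M G) {p : ℕ}

instance powersTensor_normal : (X.powersTensor p).Normal :=
  ⟨fun t ht s => by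
    rw [mul_mul_inv_eq_tensorAct]
    exact tensorAct_mem_powersTensor _ ht⟩

theorem closure_tm_eq_top : Subgroup.closure {t | ∃ m g, X.tm m g = t} = ⊤ :=
  eq_top_iff.mpr fun t _ =>
    X.mem_of_tm_mem (Subgroup.closure {t | ∃ m g, X.tm m g = t})
      (fun m g => Subgroup.subset_closure ⟨m, g, rfl⟩) t

theorem commutator_top_le_powersTensor
    (hG : ⁅X.toHom.range, (⊤ : Subgroup G)⁆ ≤ X.toHom.range.nthPowers p) :
    ⁅(⊤ : Subgroup X.TensorId), (⊤ : Subgroup X.TensorId)⁆ ≤ X.powersTensor p := by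
  refine commutator_top_le_of_closure_eq_top X.closure_tm_eq_top ?_
  rintro _ ⟨m, g, rfl⟩ _ ⟨m', g', rfl⟩
  -- The boundary of `m ⊗ g` is `μ(m ᵍm⁻¹)`, so `tm_commutator` applies with `m ᵍm⁻¹` as left
  -- factor.
  have h : ⁅X.tm m g, X.tm m' g'⁆ = X.tm (m * X.act g m⁻¹) ⁅X.toHom m', g'⁆ := by
    rw [tm_commutator, commutatorElement_def, mul_mul_inv_eq_tensorAct, boundary_tm,
      commutatorElement_def, map_mul X.toHom, toHom_act, map_inv]
    simp only [mul_assoc]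
  rw [h]
  exact tm_mem_powersTensor_right _
    (hG (Subgroup.commutator_mem_commutator ⟨m', rfl⟩ (Subgroup.mem_top g')))

/-! ### The tensor product modulo `p` -/

variable (p)

/-- The tensor product modulo `p` of a crossed module `M → G` with the identity. -/
abbrev QTensorId : Type (max u w) := QTensor p X (identity G)

/-- The generator `{k}` of the tensor product modulo `p`. -/
def brace (k : pullback X (identity G)) : X.QTensorId p :=
  PresentedGroup.of (QTensorGen.brace k)

/-- The natural homomorphism from the tensor product to the tensor product modulo `p`. -/
def toQTensor : X.TensorId →* X.QTensorId p :=
  X.liftTensor (fun m g => PresentedGroup.of (QTensorGen.tmul m g))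
    (fun m g g' => PresentedGroup.mk_eq_mk_of_mul_inv_mem (QTensorRel.right m g g'))
    (fun m m' g => by
      rw [← X.act_toHom]
      exact PresentedGroup.mk_eq_mk_of_mul_inv_mem (QTensorRel.left m m' g))

@[simp]
theorem toQTensor_tm (m : M) (g : G) :
    X.toQTensor p (X.tm m g) = PresentedGroup.of (QTensorGen.tmul m g) :=
  liftTensor_tm ..

theorem mem_of_brace_mem (H : Subgroup (X.QTensorId p)) (ht : ∀ m g, X.toQTensor p (X.tm m g) ∈ H)
    (hb : ∀ k, X.brace p k ∈ H) (x : X.QTensorId p) : x ∈ H := by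
  refine PresentedGroup.generated_by _ H ?_ x
  rintro (⟨m, g⟩ | k)
  · rw [← toQTensor_tm]
    exact ht m g
  · exact hb k

theorem brace_conj (k : pullback X (identity G)) (t : X.TensorId) :
    X.brace p k * X.toQTensor p t * (X.brace p k)⁻¹ =
      X.toQTensor p (X.tensorAct (X.toHom ((k : M × G).1 ^ p)) t) := by
  have key : (MulAut.conj (X.brace p k)).toMonoidHom.comp (X.toQTensor p) =
      (X.toQTensor p).comp (X.tensorAct (X.toHom ((k : M × G).1 ^ p))).toMonoidHom := by
    refine tensor_hom_ext fun m g => ?_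
    change X.brace p k * X.toQTensor p (X.tm m g) * (X.brace p k)⁻¹ =
      X.toQTensor p (X.tensorAct (X.toHom ((k : M × G).1 ^ p)) (X.tm m g))
    rw [tensorAct_tm, toQTensor_tm, toQTensor_tm]
    exact PresentedGroup.mk_eq_mk_of_mul_inv_mem (QTensorRel.conj k m g)
  exact DFunLike.congr_fun key t

instance range_toQTensor_normal : (X.toQTensor p).range.Normal := by
  rw [← Subgroup.normalizer_eq_top_iff, eq_top_iff]
  intro x _
  refine X.mem_of_brace_mem p _ (fun m g => ?_) (fun k => ?_) x
  · exact Subgroup.le_normalizer (MonoidHom.mem_range.mpr ⟨_, rfl⟩)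
  · rw [Subgroup.mem_normalizer_iff]
    intro y
    constructor
    · rintro ⟨t, rfl⟩
      exact ⟨_, (X.brace_conj p k t).symm⟩
    · rintro ⟨t, ht⟩
      refine ⟨X.tensorAct (X.toHom ((k : M × G).1 ^ p))⁻¹ t, ?_⟩
      have h := X.brace_conj p k (X.tensorAct (X.toHom ((k : M × G).1 ^ p))⁻¹ t)
      rw [← tensorAct_mul_apply, mul_inv_cancel, map_one, MulAut.one_apply, ht] at h
      exact mul_left_cancel (mul_right_cancel h)

/-- The middle product in the relation for `{kk'}` consists of tensors, hence dies in the quotient.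
-/
theorem brace_mul_mk (k k' : pullback X (identity G)) :
    (X.brace p (k * k') : X.QTensorId p ⧸ (X.toQTensor p).range) =
      X.brace p k * X.brace p k' := by
  have h := PresentedGroup.mk_eq_mk_of_mul_inv_mem
    (rels := {r | QTensorRel p X (identity G) r}) (QTensorRel.mul k k')
  rw [map_mul, map_mul, map_list_prod, List.map_map] at h
  change X.brace p (k * k') = X.brace p k * List.prod _ * X.brace p k' at h
  rw [h, QuotientGroup.mk_mul, QuotientGroup.mk_mul]
  congr 1
  rw [mul_eq_left, QuotientGroup.eq_one_iff]
  refine Subgroup.list_prod_mem _ fun x hx => ?_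
  obtain ⟨i, _, rfl⟩ := List.mem_map.mp hx
  exact ⟨X.tm _ _, toQTensor_tm ..⟩

/-- The homomorphism induced by `k ↦ {k}` modulo the image of the tensor product. -/
def braceHom : pullback X (identity G) →* X.QTensorId p ⧸ (X.toQTensor p).range :=
  MonoidHom.mk' (fun k => (X.brace p k : X.QTensorId p ⧸ (X.toQTensor p).range))
    (X.brace_mul_mk p)

theorem braceHom_surjective : Function.Surjective (X.braceHom p) := by
  intro y
  obtain ⟨x, rfl⟩ := QuotientGroup.mk_surjective y
  refine X.mem_of_brace_mem p ((X.braceHom p).range.comap (QuotientGroup.mk' _))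
    (fun m g => MonoidHom.mem_range.mpr ⟨1, ?_⟩) (fun k => ⟨k, rfl⟩) x
  rw [map_one]
  exact ((QuotientGroup.eq_one_iff _).mpr (MonoidHom.mem_range.mpr ⟨_, rfl⟩)).symm

/-- The group is an extension of a quotient of `K ≤ M × G` by a quotient of `M ⊗ G`. -/
theorem finite_isPGroup_qTensorId [Finite M] [Finite G] [Fact p.Prime]
    (hM : IsPGroup p M) (hG : IsPGroup p G) :
    Finite (X.QTensorId p) ∧ IsPGroup p (X.QTensorId p) := by
  obtain ⟨hfin, hT⟩ := X.finite_isPGroup_tensorId hM hG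
  have hMG : IsPGroup p (M × G) := by
    obtain ⟨a, ha⟩ := IsPGroup.iff_card.mp hM
    obtain ⟨b, hb⟩ := IsPGroup.iff_card.mp hG
    exact IsPGroup.of_card (n := a + b) (by rw [Nat.card_prod, ha, hb, pow_add])
  have hquot := (hMG.to_subgroup (pullback X (identity G))).of_surjective _
    (X.braceHom_surjective p)
  have := Finite.of_surjective _ (X.braceHom_surjective p)
  have : Finite (X.toQTensor p).range :=
    Finite.of_surjective _ (X.toQTensor p).rangeRestrict_surjective
  exact ⟨Finite.of_subgroup_quotient (X.toQTensor p).range,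
    (hT.of_surjective _ (X.toQTensor p).rangeRestrict_surjective).of_quotient hquot⟩

theorem commutator_qTensorId_le
    (hG : ⁅X.toHom.range, (⊤ : Subgroup G)⁆ ≤ X.toHom.range.nthPowers p)
    (hR : X.powersTensor p ≤ (⊤ : Subgroup X.TensorId).nthPowers p) :
    ⁅(⊤ : Subgroup (X.QTensorId p)), (⊤ : Subgroup (X.QTensorId p))⁆ ≤
      (⊤ : Subgroup (X.QTensorId p)).nthPowers p := by
  have hmem {t : X.TensorId} (ht : t ∈ X.powersTensor p) :
      X.toQTensor p t ∈ (⊤ : Subgroup (X.QTensorId p)).nthPowers p :=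
    Subgroup.map_mem_nthPowers _ (fun _ _ => Subgroup.mem_top _) (hR ht)
  have hbt (k) (m : M) (g : G) : ⁅X.brace p k, X.toQTensor p (X.tm m g)⁆ ∈
      (⊤ : Subgroup (X.QTensorId p)).nthPowers p := by
    rw [commutatorElement_def, brace_conj, ← map_inv, ← map_mul, ← tm_commutator]
    exact hmem (tm_mem_powersTensor_left (Subgroup.pow_mem_nthPowers (Subgroup.mem_top _)) _)
  have hgen : Subgroup.closure ({x | ∃ m g, X.toQTensor p (X.tm m g) = x} ∪
      Set.range (X.brace p)) = ⊤ :=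
    eq_top_iff.mpr fun x _ => X.mem_of_brace_mem p (Subgroup.closure _)
      (fun m g => Subgroup.subset_closure (Or.inl ⟨m, g, rfl⟩))
      (fun k => Subgroup.subset_closure (Or.inr ⟨k, rfl⟩)) x
  refine commutator_top_le_of_closure_eq_top hgen ?_
  rintro _ (⟨m, g, rfl⟩ | ⟨k, rfl⟩) _ (⟨m', g', rfl⟩ | ⟨k', rfl⟩)
  · rw [← map_commutatorElement]
    exact hmem (X.commutator_top_le_powersTensor hG
      (Subgroup.commutator_mem_commutator (Subgroup.mem_top _) (Subgroup.mem_top _)))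
  · rw [← commutatorElement_inv]
    exact inv_mem (hbt k' m g)
  · exact hbt k m' g'
  · have h : ⁅X.brace p k, X.brace p k'⁆ =
        X.toQTensor p (X.tm ((k : M × G).1 ^ p) ((k' : M × G).2 ^ p)) := by
      rw [toQTensor_tm]
      exact PresentedGroup.mk_eq_mk_of_mul_inv_mem (QTensorRel.comm k k')
    rw [h]
    exact hmem (tm_mem_powersTensor_left (Subgroup.pow_mem_nthPowers (Subgroup.mem_top _)) _)

end TensorIdentity

end CrossedModule

theorem theoremC {M : Type u} {G : Type w} [Group M] [Group G] [Finite M] [Finite G]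
    (p : ℕ) (hp : p.Prime) (hodd : Odd p) (hM : IsPGroup p M) (hG : IsPGroup p G)
    (μ : CrossedModule M G) (hpow : Powerful p M)
    (hemb : PowerfullyEmbedded p μ.toHom.range) :
    (μ.tensorPowers p).range ≤
        (⊤ : Subgroup (μ.Tensor (CrossedModule.identity G))).nthPowers p ∧
      (Finite (μ.Tensor (CrossedModule.identity G)) ∧
        IsPGroup p (μ.Tensor (CrossedModule.identity G)) ∧
        Powerful p (μ.Tensor (CrossedModule.identity G))) ∧
      (Finite (CrossedModule.QTensor p μ (CrossedModule.identity G)) ∧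
        IsPGroup p (CrossedModule.QTensor p μ (CrossedModule.identity G)) ∧
        Powerful p (CrossedModule.QTensor p μ (CrossedModule.identity G))) := by
  have := Fact.mk hp
  have h2 : p ≠ 2 := by rintro rfl; exact absurd hodd (by decide)
  simp only [Powerful, PowerfullyEmbedded, if_neg h2] at hpow hemb ⊢
  have hR := CrossedModule.powersTensor_le_nthPowers hodd hM hG hpow hemb.2
  obtain ⟨hT₁, hT₂⟩ := μ.finite_isPGroup_tensorId hM hG
  obtain ⟨hQ₁, hQ₂⟩ := μ.finite_isPGroup_qTensorId p hM hG
  refine ⟨?_, ⟨hT₁, hT₂, (μ.commutator_top_le_powersTensor hemb.2).trans hR⟩,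
    hQ₁, hQ₂, μ.commutator_qTensorId_le p hemb.2 hR⟩
  rintro _ ⟨t, rfl⟩
  refine PresentedGroup.generated_by _
    (((⊤ : Subgroup μ.TensorId).nthPowers p).comap (μ.tensorPowers p)) ?_ t
  rintro ⟨⟨m, hm⟩, g⟩
  refine hR ?_
  have h : μ.tensorPowers p (PresentedGroup.of (⟨m, hm⟩, g)) = μ.tm m g := by
    unfold CrossedModule.tensorPowers CrossedModule.Tensor.mapLeft
    exact PresentedGroup.toGroup.of _
  rw [h]
  exact CrossedModule.tm_mem_powersTensor_left hm g
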